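/- Let $d\in\mathbb N$, let $\mathcal H_d=\mathbb C^d$ be the Hilbert space of a qudit and $\mathcal H_\infty=L^2(\mathbb R)$ the Hilbert space of a single bosonic mode, and let $\hat\rho$ be a density operator (positive, trace one) on $\mathcal H_d\otimes\mathcal H_\infty$. Call $\hat\rho$ a product state if $\hat\rho=\hat\rho^A\otimes\hat\rho^B$ with density operators $\hat\rho^A,\hat\rho^B$; separable if it is a finite or countable convex combination $\sum_i p_i\,\hat\rho_i^A\otimes\hat\rho_i^B$ of product states; entangled if it is not separable; and classically correlated if it is separable but not a product state. A state $\hat\sigma$ of $N$ modes, i.e. a density operator on $L^2(\mathbb R^N)$, is called Gaussian if its characteristic function $\chi(\xi)=\mathrm{tr}\bigl[e^{\,i\sum_{j=1}^N(\xi_{2j-1}\hat p_j-\xi_{2j}\hat x_j)}\,\hat\sigma\bigr]$, $\xi\in\mathbb R^{2N}$, where $[\hat x_j,\hat p_k]=i\delta_{jk}$, has the form $$\chi(\xi)=\chi(0)\,e^{-\frac14\xi^TJ_N^T\gamma J_N\xi+i\xi^TJ_ND}$$ for some real symmetric $2N\times2N$ matrix $\gamma$ and some $D\in\mathbb R^{2N}$,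 where $J_N=\bigoplus_{j=1}^N\begin{pmatrix}0&1\\-1&0\end{pmatrix}$. Gaussianity of $\hat\rho$ refers to a realization of the qudit by a mode: for an isometry $V:\mathcal H_d\to L^2(\mathbb R)$ (for instance the one that sends the basis vector $|m\rangle$ to the $m$-th Fock state, $0\le m<d$), regard $\hat\rho$ as the two-mode state $(V\otimes\mathbb 1)\,\hat\rho\,(V\otimes\mathbb 1)^\dagger$ on $L^2(\mathbb R^2)$. Theorem. If $\hat\rho$ is entangled or classically correlated, then it is non-Gaussian: for every isometry $V:\mathcal H_d\to L^2(\mathbb R)$, the two-mode state $(V\otimes\mathbb 1)\,\hat\rho\,(V\otimes\mathbb 1)^\dagger$ is not Gaussian. -/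

import Mathlib

open MeasureTheory Complex
open scoped TensorProduct Matrix Kronecker InnerProductSpace ENNReal

noncomputable section

namespace HybridEntanglement

section DensityOperators

/-- Density operator on a complex Hilbert space: a bounded positive operator of trace one, the
trace being computed in an arbitrary orthonormal basis. -/
def IsDensityOperator {H : Type} [NormedAddCommGroup H] [InnerProductSpace ℂ H]
    (ρ : H →L[ℂ] H) : Prop :=
  ρ.IsPositive ∧
    ∀ (ι : Type) (b : HilbertBasis ι ℂ H), HasSum (fun i => ⟪b i, ρ (b i)⟫_ℂ) 1

/-- A fixed orthonormal basis, used only to write down the trace. -/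
def stdHilbertBasis (H : Type) [NormedAddCommGroup H] [InnerProductSpace ℂ H] [CompleteSpace H] :
    HilbertBasis (exists_hilbertBasis ℂ H).choose ℂ H :=
  (exists_hilbertBasis ℂ H).choose_spec.choose

/-- The trace of an operator on a Hilbert space; it is applied to trace-class operators only, for
which the sum converges absolutely and does not depend on the basis. -/
def opTrace {H : Type} [NormedAddCommGroup H] [InnerProductSpace ℂ H] [CompleteSpace H]
    (T : H →L[ℂ] H) : ℂ :=
  ∑' i, ⟪stdHilbertBasis H i, T (stdHilbertBasis H i)⟫_ℂ

variable {E F : Type} [NormedAddCommGroup E] [InnerProductSpace ℂ E]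
  [NormedAddCommGroup F] [InnerProductSpace ℂ F]

/-- `ρ = ρ_A ⊗ ρ_B` with density operators `ρ_A`, `ρ_B`: an uncorrelated state. -/
def IsProductState (ρ : (E ⊗[ℂ] F) →L[ℂ] (E ⊗[ℂ] F)) : Prop :=
  ∃ (A : E →L[ℂ] E) (B : F →L[ℂ] F),
    IsDensityOperator A ∧ IsDensityOperator B ∧ ρ = TensorProduct.mapL A B

/-- `ρ = ∑ i, p i • (A i ⊗ B i)`, a finite or countable convex combination of product states.
Finite sums are included, since weights are allowed to vanish. -/
def IsSeparable (ρ : (E ⊗[ℂ] F) →L[ℂ] (E ⊗[ℂ] F)) : Prop :=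
  ∃ (p : ℕ → ℝ) (A : ℕ → E →L[ℂ] E) (B : ℕ → F →L[ℂ] F),
    (∀ i, 0 ≤ p i) ∧ HasSum p 1 ∧
    (∀ i, IsDensityOperator (A i)) ∧ (∀ i, IsDensityOperator (B i)) ∧
    HasSum (fun i => (p i : ℂ) • TensorProduct.mapL (A i) (B i)) ρ

/-- Entangled: not separable. -/
def IsEntangled (ρ : (E ⊗[ℂ] F) →L[ℂ] (E ⊗[ℂ] F)) : Prop :=
  ¬ IsSeparable ρ

/-- Classically correlated: separable, but not an uncorrelated product state. -/
def IsClassicallyCorrelated (ρ : (E ⊗[ℂ] F) →L[ℂ] (E ⊗[ℂ] F)) : Prop :=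
  IsSeparable ρ ∧ ¬ IsProductState ρ

end DensityOperators

section Modes

/-- The Hilbert space `L²(ℝ^N)` of `N` modes, in the position representation. -/
abbrev ModeSpace (N : ℕ) : Type := Lp ℂ 2 (volume : Measure (Fin N → ℝ))

/-- The Hilbert space `L²(ℝ)` of a single qumode, in the position representation. -/
abbrev Qumode : Type := Lp ℂ 2 (volume : Measure ℝ)

/-- The phase space `ℝ^(2N)`; the coordinates `(j, 0)` and `(j, 1)` belong to mode `j`. -/
abbrev PhaseSpace (N : ℕ) : Type := Fin N × Fin 2 → ℝ

/-- The phase `exp(-i ∑_j (ξ_{j,1} x_j + ξ_{j,0} ξ_{j,1} / 2))` of the Weyl operator. -/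
def weylPhase {N : ℕ} (ξ : PhaseSpace N) (x : Fin N → ℝ) : ℂ :=
  Complex.exp (-(I * ((∑ j, (ξ (j, 1) * x j + ξ (j, 0) * ξ (j, 1) / 2) : ℝ) : ℂ)))

lemma norm_weylPhase {N : ℕ} (ξ : PhaseSpace N) (x : Fin N → ℝ) : ‖weylPhase ξ x‖ = 1 := by
  rw [weylPhase, ← mul_neg, ← Complex.ofReal_neg, mul_comm]
  exact Complex.norm_exp_ofReal_mul_I _

lemma continuous_weylPhase {N : ℕ} (ξ : PhaseSpace N) : Continuous (weylPhase ξ) := by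
  unfold weylPhase
  fun_prop

lemma measurePreserving_shift {N : ℕ} (ξ : PhaseSpace N) :
    MeasurePreserving (fun x : Fin N → ℝ => x + fun j => ξ (j, 0)) volume volume :=
  measurePreserving_add_right volume _

lemma memLp_weyl {N : ℕ} (ξ : PhaseSpace N) (f : ModeSpace N) :
    MemLp (fun x => weylPhase ξ x * f (x + fun j => ξ (j, 0))) 2 volume := by
  have h : MemLp (fun x => f (x + fun j => ξ (j, 0))) 2 volume :=
    (Lp.memLp f).comp_measurePreserving (measurePreserving_shift ξ)
  refine h.of_le ((continuous_weylPhase ξ).aestronglyMeasurable.mul h.1) ?_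
  exact Filter.Eventually.of_forall fun x => by rw [norm_mul, norm_weylPhase, one_mul]

/-- The Weyl operator `exp(i ∑_j (ξ_{j,0} p_j - ξ_{j,1} x_j))` in the position representation, with
`p_j = -i ∂/∂x_j`: by the Weyl relations it maps a wave function `f` to
`x ↦ exp(-i ∑_j (ξ_{j,1} x_j + ξ_{j,0} ξ_{j,1} / 2)) f(x + (ξ_{j,0})_j)`. -/
def weyl {N : ℕ} (ξ : PhaseSpace N) : ModeSpace N →ₗᵢ[ℂ] ModeSpace N where
  toFun f := (memLp_weyl ξ f).toLp _
  map_add' f g := by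
    rw [← MemLp.toLp_add]
    refine MemLp.toLp_congr _ _ ?_
    have h := (measurePreserving_shift ξ).quasiMeasurePreserving.ae_eq_comp (Lp.coeFn_add f g)
    filter_upwards [h] with x hx
    simp only [Function.comp_apply, Pi.add_apply] at hx ⊢
    rw [hx, mul_add]
  map_smul' c f := by
    rw [RingHom.id_apply, ← MemLp.toLp_const_smul]
    refine MemLp.toLp_congr _ _ ?_
    have h := (measurePreserving_shift ξ).quasiMeasurePreserving.ae_eq_comp (Lp.coeFn_smul c f)
    filter_upwards [h] with x hx
    simp only [Function.comp_apply, Pi.smul_apply, smul_eq_mul] at hx ⊢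
    rw [hx]
    ring
  norm_map' f := by
    simp only [LinearMap.coe_mk, AddHom.coe_mk]
    rw [Lp.norm_toLp, Lp.norm_def]
    congr 1
    rw [← eLpNorm_comp_measurePreserving (Lp.aestronglyMeasurable f) (measurePreserving_shift ξ)]
    refine eLpNorm_congr_norm_ae (Filter.Eventually.of_forall fun x => ?_)
    simp [norm_weylPhase]

/-- The characteristic function `χ(ξ) = tr(W_ξ ρ)` of a state of `N` modes. -/
def charFn {N : ℕ} (ρ : ModeSpace N →L[ℂ] ModeSpace N) (ξ : PhaseSpace N) : ℂ :=
  opTrace ((weyl ξ).toContinuousLinearMap ∘L ρ)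

/-- The symplectic matrix `J ⊕ ⋯ ⊕ J` (`N` summands) with `J = !![0, 1; -1, 0]`. -/
def symplecticMatrix (N : ℕ) : Matrix (Fin N × Fin 2) (Fin N × Fin 2) ℝ :=
  (1 : Matrix (Fin N) (Fin N) ℝ) ⊗ₖ !![0, 1; -1, 0]

/-- A state of `N` modes is Gaussian if its characteristic function is
`χ(ξ) = χ(0) exp(-¼ ξᵀ Jᵀ γ J ξ + i ξᵀ J D)` for a real symmetric matrix `γ` and a real
vector `D`. -/
def IsGaussian {N : ℕ} (ρ : ModeSpace N →L[ℂ] ModeSpace N) : Prop :=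
  ∃ (γ : Matrix (Fin N × Fin 2) (Fin N × Fin 2) ℝ) (D : PhaseSpace N), γ.IsSymm ∧
    ∀ ξ : PhaseSpace N, charFn ρ ξ = charFn ρ 0 * Complex.exp
      (-(1 / 4) *
          ((ξ ⬝ᵥ (((symplecticMatrix N)ᵀ * γ * symplecticMatrix N) *ᵥ ξ) : ℝ) : ℂ)
        + I * ((ξ ⬝ᵥ (symplecticMatrix N *ᵥ D) : ℝ) : ℂ))

lemma memLp_mul_pair (f g : Qumode) :
    MemLp (fun x : Fin 2 → ℝ => f (x 0) * g (x 1)) 2 volume := by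
  have hf : AEStronglyMeasurable (fun x : Fin 2 → ℝ => f (x 0)) volume :=
    (Lp.aestronglyMeasurable f).comp_quasiMeasurePreserving
      (Measure.quasiMeasurePreserving_eval (fun _ : Fin 2 => (volume : Measure ℝ)) 0)
  have hg : AEStronglyMeasurable (fun x : Fin 2 → ℝ => g (x 1)) volume :=
    (Lp.aestronglyMeasurable g).comp_quasiMeasurePreserving
      (Measure.quasiMeasurePreserving_eval (fun _ : Fin 2 => (volume : Measure ℝ)) 1)
  have hfg : AEStronglyMeasurable (fun x : Fin 2 → ℝ => f (x 0) * g (x 1)) volume := hf.mul hg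
  rw [memLp_two_iff_integrable_sq_norm hfg]
  have hf2 := (memLp_two_iff_integrable_sq_norm (Lp.aestronglyMeasurable f)).1 (Lp.memLp f)
  have hg2 := (memLp_two_iff_integrable_sq_norm (Lp.aestronglyMeasurable g)).1 (Lp.memLp g)
  have h : Integrable (fun x : Fin 2 → ℝ =>
      ∏ i, (![fun t : ℝ => ‖f t‖ ^ 2, fun t : ℝ => ‖g t‖ ^ 2] i) (x i)) volume := by
    refine Integrable.fintype_prod (μ := fun _ : Fin 2 => (volume : Measure ℝ)) ?_
    intro i
    fin_cases i
    · exact hf2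
    · exact hg2
  refine h.congr (Filter.Eventually.of_forall fun x => ?_)
  simp [Fin.prod_univ_two, mul_pow]

lemma ae_comp_eval {i : Fin 2} {u v : ℝ → ℂ} (h : u =ᵐ[volume] v) :
    (fun x : Fin 2 → ℝ => u (x i)) =ᵐ[volume] fun x => v (x i) :=
  (Measure.quasiMeasurePreserving_eval (fun _ : Fin 2 => (volume : Measure ℝ)) i).ae_eq_comp h

/-- The bilinear map sending `f, g ∈ L²(ℝ)` to the two-mode wave function
`(x₀, x₁) ↦ f(x₀) g(x₁)`. -/
def pairBilin : Qumode →ₗ[ℂ] Qumode →ₗ[ℂ] ModeSpace 2 :=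
  LinearMap.mk₂ ℂ (fun f g => (memLp_mul_pair f g).toLp _)
    (fun f f' g => by
      rw [← MemLp.toLp_add]
      refine MemLp.toLp_congr _ _ ?_
      filter_upwards [ae_comp_eval (i := 0) (Lp.coeFn_add f f')] with x hx
      simp only [Pi.add_apply] at hx ⊢
      rw [hx, add_mul])
    (fun c f g => by
      rw [← MemLp.toLp_const_smul]
      refine MemLp.toLp_congr _ _ ?_
      filter_upwards [ae_comp_eval (i := 0) (Lp.coeFn_smul c f)] with x hx
      simp only [Pi.smul_apply, smul_eq_mul] at hx ⊢
      rw [hx, mul_assoc])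
    (fun f g g' => by
      rw [← MemLp.toLp_add]
      refine MemLp.toLp_congr _ _ ?_
      filter_upwards [ae_comp_eval (i := 1) (Lp.coeFn_add g g')] with x hx
      simp only [Pi.add_apply] at hx ⊢
      rw [hx, mul_add])
    (fun c f g => by
      rw [← MemLp.toLp_const_smul]
      refine MemLp.toLp_congr _ _ ?_
      filter_upwards [ae_comp_eval (i := 1) (Lp.coeFn_smul c g)] with x hx
      simp only [Pi.smul_apply, smul_eq_mul] at hx ⊢
      rw [hx, mul_left_comm])

lemma inner_pairBilin (f g f' g' : Qumode) :
    ⟪pairBilin f g, pairBilin f' g'⟫_ℂ = ⟪f, f'⟫_ℂ * ⟪g, g'⟫_ℂ := by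
  rw [L2.inner_def, L2.inner_def, L2.inner_def]
  have h := integral_fintype_prod_volume_eq_prod
    (![fun t : ℝ => ⟪f t, f' t⟫_ℂ, fun t : ℝ => ⟪g t, g' t⟫_ℂ])
  simp only [Fin.prod_univ_two, Matrix.cons_val_zero, Matrix.cons_val_one] at h
  rw [← h]
  refine integral_congr_ae ?_
  filter_upwards [(memLp_mul_pair f g).coeFn_toLp, (memLp_mul_pair f' g').coeFn_toLp] with x h1 h2
  simp only [pairBilin, LinearMap.mk₂_apply]
  rw [h1, h2]
  simp only [RCLike.inner_apply, map_mul]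
  ring

/-- The canonical isometric embedding of `L²(ℝ) ⊗ L²(ℝ)` (algebraic tensor product) in the
two-mode space `L²(ℝ²)`, `f ⊗ g ↦ ((x₀, x₁) ↦ f(x₀) g(x₁))`. -/
def twoModeEmbedding : (Qumode ⊗[ℂ] Qumode) →ₗᵢ[ℂ] ModeSpace 2 :=
  (TensorProduct.lift pairBilin).isometryOfInner fun x y => by
    induction x using TensorProduct.induction_on with
    | zero => simp
    | add x₁ x₂ h₁ h₂ => rw [map_add, inner_add_left, inner_add_left, h₁, h₂]
    | tmul f g =>
      induction y using TensorProduct.induction_on with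
      | zero => simp
      | add y₁ y₂ h₁ h₂ => rw [map_add, inner_add_right, inner_add_right, h₁, h₂]
      | tmul f' g' =>
        rw [TensorProduct.lift.tmul, TensorProduct.lift.tmul, inner_pairBilin,
          TensorProduct.inner_tmul]

end Modes

section Hybrid

/-- The Hilbert space `H_d` of a qudit. -/
abbrev Qudit (d : ℕ) : Type := EuclideanSpace ℂ (Fin d)

/-- The hybrid Hilbert space `H_d ⊗ H_∞`. As `H_d` is finite-dimensional, the algebraic tensor
product is already complete. -/
abbrev HybridSpace (d : ℕ) : Type := Qudit d ⊗[ℂ] Qumode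

/-- `(f_m)_m ↦ ∑ m, |m⟩ ⊗ f_m` -/
def hybridIsometry (d : ℕ) : PiLp 2 (fun _ : Fin d => Qumode) →ₗᵢ[ℂ] HybridSpace d :=
  LinearMap.isometryOfInner
    (E := PiLp 2 (fun _ : Fin d => Qumode)) (E' := HybridSpace d)
    { toFun := fun f => ∑ m, EuclideanSpace.single m (1 : ℂ) ⊗ₜ[ℂ] f m
      map_add' := fun f g => by
        simp [TensorProduct.tmul_add, Finset.sum_add_distrib]
      map_smul' := fun c f => by
        simp [Finset.smul_sum] }
    fun f g => by
      simp [sum_inner, inner_sum, PiLp.inner_apply]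

lemma hybridIsometry_surjective (d : ℕ) : Function.Surjective (hybridIsometry d) := by
  intro x
  induction x using TensorProduct.induction_on with
  | zero => exact ⟨0, map_zero _⟩
  | add x y hx hy =>
    obtain ⟨a, rfl⟩ := hx
    obtain ⟨b, rfl⟩ := hy
    exact ⟨a + b, map_add _ _ _⟩
  | tmul v f =>
    refine ⟨WithLp.toLp 2 fun m => v m • f, ?_⟩
    have hv : v = ∑ m, v m • EuclideanSpace.single m (1 : ℂ) := by
      ext k
      simp [Pi.single_apply]
    conv_rhs => rw [hv, TensorProduct.sum_tmul]
    change ∑ m, EuclideanSpace.single m (1 : ℂ) ⊗ₜ[ℂ] (v m • f) = _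
    exact Finset.sum_congr rfl fun m _ => (TensorProduct.smul_tmul _ _ _).symm

instance hybridSpace_complete (d : ℕ) : CompleteSpace (HybridSpace d) :=
  (LinearIsometryEquiv.ofSurjective (hybridIsometry d)
    (hybridIsometry_surjective d)).toIsometryEquiv.symm.completeSpace

/-- Given a realization `V` of the qudit by a mode (an isometry `H_d → L²(ℝ)`, for instance the one
sending `|m⟩` to the `m`-th Fock state), the isometry `V ⊗ 1` from `H_d ⊗ H_∞` to the two-mode
space `L²(ℝ²)`. -/
def hybridEmbedding {d : ℕ} (V : Qudit d →ₗᵢ[ℂ] Qumode) : HybridSpace d →ₗᵢ[ℂ] ModeSpace 2 :=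
  twoModeEmbedding.comp (V.rTensor Qumode)

/-- The two-mode state `(V ⊗ 1) ρ (V ⊗ 1)†`. -/
def toTwoModes {d : ℕ} (V : Qudit d →ₗᵢ[ℂ] Qumode) (ρ : HybridSpace d →L[ℂ] HybridSpace d) :
    ModeSpace 2 →L[ℂ] ModeSpace 2 :=
  (hybridEmbedding V).toContinuousLinearMap ∘L ρ ∘L
    ContinuousLinearMap.adjoint (hybridEmbedding V).toContinuousLinearMap

end Hybrid

end HybridEntanglement

end

open MeasureTheory Complex
open scoped TensorProduct Matrix Kronecker InnerProductSpace ENNReal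

noncomputable section

namespace HybridEntanglement

/-! ### Hilbert-Schmidt operators and cyclicity of the trace. -/

section HilbertSchmidt

variable {H K : Type} [NormedAddCommGroup H] [InnerProductSpace ℂ H]
  [NormedAddCommGroup K] [InnerProductSpace ℂ K] {ι κ : Type}

/-! The contrapositive is proved in a strong form: a Gaussian hybrid state is a product state, which
rules out both entanglement and classical correlation. Only the characteristic function on the phase
space of the first mode is needed.

There it is the Weyl symbol of the reduced qudit state, an operator on `L²(ℝ)` with kernel `k(x, y)
= ∑ G m n * conj (v m x) * v n y`, of finite rank since the qudit has dimension `d`. Inverting the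
Fourier transform (`exists_kernel_eq_exp`) turns a Gaussian symbol into `k(x, y) = exp(u x + w y + β
x y)`. If `β ≠ 0`, the functions `exp(β x y)` of `y`, for infinitely many `x`, are linearly
independent, against finite rank (`cross_term_eq_zero`). So `β = 0`, the kernel splits, and `G` has
rank one (`exists_rank_one`): the marginal is pure. A state with a pure marginal is a product
(`isProductState_of_range`).

Traces are handled by writing `ρ = S ∘L S` with `S` self-adjoint and Hilbert-Schmidt, so that every
trace becomes an absolutely convergent sum over the vectors `S (b i)`. -/

theorem hasSum_norm_inner_sq (b : HilbertBasis ι ℂ H) (x : H) :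
    HasSum (fun i => ‖⟪b i, x⟫_ℂ‖ ^ 2) (‖x‖ ^ 2) := by
  have h := (b.hasSum_inner_mul_inner x x).mapL reCLM
  rw [inner_self_eq_norm_sq_to_K] at h
  convert h using 1
  · ext i
    rw [← inner_conj_symm x (b i), mul_comm, Complex.mul_conj, Complex.normSq_eq_norm_sq]
    simp [-ofReal_pow]
  · simp [← ofReal_pow]

theorem summable_norm_inner_sq (b : HilbertBasis ι ℂ H) (e : HilbertBasis κ ℂ K) (T : H →L[ℂ] K)
    (hT : Summable fun i => ‖T (b i)‖ ^ 2) :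
    Summable fun p : ι × κ => ‖⟪e p.2, T (b p.1)⟫_ℂ‖ ^ 2 := by
  refine (summable_prod_of_nonneg fun p => sq_nonneg _).2
    ⟨fun i => (hasSum_norm_inner_sq e (T (b i))).summable, ?_⟩
  simpa only [(hasSum_norm_inner_sq e _).tsum_eq] using hT

theorem mul_le_add_sq (x y : ℝ) : y * x ≤ x ^ 2 + y ^ 2 := by
  nlinarith [sq_nonneg (x - y), sq_nonneg x, sq_nonneg y]

/-- Absolute convergence of the double array is what permits summing it by rows or by columns; this
exchange is the whole content of cyclicity of the trace. -/
theorem summable_inner_mul_inner (b : HilbertBasis ι ℂ H) (e : HilbertBasis κ ℂ K)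
    (X A : H →L[ℂ] K) (hX : Summable fun i => ‖X (b i)‖ ^ 2)
    (hA : Summable fun i => ‖A (b i)‖ ^ 2) :
    Summable fun p : ι × κ => ⟪A (b p.1), e p.2⟫_ℂ * ⟪e p.2, X (b p.1)⟫_ℂ := by
  have h1 := summable_norm_inner_sq b e X hX
  have h2 := summable_norm_inner_sq b e A hA
  refine Summable.of_norm_bounded (h1.add h2) fun p => ?_
  rw [norm_mul, norm_inner_symm (𝕜 := ℂ) (A _)]
  exact mul_le_add_sq _ _

variable [CompleteSpace H] [CompleteSpace K]

/-- The Hilbert-Schmidt norm may be computed in any basis, and the adjoint has the same one. -/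
theorem hasSum_norm_adjoint_sq (b : HilbertBasis ι ℂ H) (e : HilbertBasis κ ℂ K) (T : H →L[ℂ] K)
    {s : ℝ} (hT : HasSum (fun i => ‖T (b i)‖ ^ 2) s) :
    HasSum (fun j => ‖ContinuousLinearMap.adjoint T (e j)‖ ^ 2) s := by
  have h := summable_norm_inner_sq b e T hT.summable
  have hs := h.hasSum
  -- By Parseval, the row sums of `‖⟪e j, T (b i)⟫‖ ^ 2` are `‖T (b i)‖ ^ 2` and the column sums are
  -- `‖T† (e j)‖ ^ 2`.
  have h1 := hs.prod_fiberwise (fun i => hasSum_norm_inner_sq e (T (b i)))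
  rw [h1.unique hT] at hs
  refine ((Equiv.prodComm κ ι).hasSum_iff.2 hs).prod_fiberwise fun j => ?_
  convert! hasSum_norm_inner_sq b (ContinuousLinearMap.adjoint T (e j)) using 2 with i
  simp only [Function.comp_apply, Equiv.prodComm_apply, Prod.swap_prod_mk]
  rw [ContinuousLinearMap.adjoint_inner_right, ← inner_conj_symm, RCLike.norm_conj]

/-- Cyclicity of the trace for a product of Hilbert-Schmidt operators. -/
theorem hasSum_inner_of_adjoint (b : HilbertBasis ι ℂ H) (e : HilbertBasis κ ℂ K)
    (X A : H →L[ℂ] K) (hX : Summable fun i => ‖X (b i)‖ ^ 2)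
    (hA : Summable fun i => ‖A (b i)‖ ^ 2) :
    HasSum (fun i => ⟪A (b i), X (b i)⟫_ℂ)
      (∑' j, ⟪e j, X (ContinuousLinearMap.adjoint A (e j))⟫_ℂ) := by
  obtain ⟨s, hs⟩ := summable_inner_mul_inner b e X A hX hA
  have h3 : HasSum (fun i => ⟪A (b i), X (b i)⟫_ℂ) s :=
    HasSum.prod_fiberwise hs fun i => e.hasSum_inner_mul_inner (A (b i)) (X (b i))
  have h4 : HasSum (fun j => ⟪e j, X (ContinuousLinearMap.adjoint A (e j))⟫_ℂ) s := by
    refine HasSum.prod_fiberwise (f := fun q : κ × ι =>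
      ⟪A (b q.2), e q.1⟫_ℂ * ⟪e q.1, X (b q.2)⟫_ℂ)
      ((Equiv.prodComm κ ι).hasSum_iff.2 hs) fun j => ?_
    have h5 := b.hasSum_inner_mul_inner (ContinuousLinearMap.adjoint X (e j))
      (ContinuousLinearMap.adjoint A (e j))
    rw [ContinuousLinearMap.adjoint_inner_left] at h5
    convert! h5 using 2 with i
    rw [ContinuousLinearMap.adjoint_inner_left, ContinuousLinearMap.adjoint_inner_right]
    exact mul_comm _ _
  rwa [h4.tsum_eq]

/-- A density operator is the square of a self-adjoint Hilbert-Schmidt operator of norm one. -/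
theorem IsDensityOperator.exists_sqrt {ρ : H →L[ℂ] H} (hρ : IsDensityOperator ρ) :
    ∃ S : H →L[ℂ] H, ContinuousLinearMap.adjoint S = S ∧ S ∘L S = ρ ∧
      ∀ (ι : Type) (b : HilbertBasis ι ℂ H), HasSum (fun i => ‖S (b i)‖ ^ 2) 1 := by
  have h0 : 0 ≤ ρ := (ContinuousLinearMap.nonneg_iff_isPositive ρ).2 hρ.1
  have hS : ContinuousLinearMap.adjoint (CFC.sqrt ρ) = CFC.sqrt ρ :=
    ((ContinuousLinearMap.nonneg_iff_isPositive _).1 (CFC.sqrt_nonneg ρ)).isSelfAdjoint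
  have hSS : CFC.sqrt ρ ∘L CFC.sqrt ρ = ρ := CFC.sqrt_mul_sqrt_self ρ h0
  refine ⟨CFC.sqrt ρ, hS, hSS, fun ι b => ?_⟩
  convert! (hρ.2 ι b).mapL reCLM using 1
  ext i
  conv_rhs => rw [← hSS]
  rw [ContinuousLinearMap.comp_apply, ← ContinuousLinearMap.adjoint_inner_left, hS,
    inner_self_eq_norm_sq_to_K]
  simp [← ofReal_pow]

end HilbertSchmidt

/-- The characteristic function of the two-mode state in terms of a square root of `ρ`. -/
theorem hasSum_charFn {d : ℕ} {S ρ : HybridSpace d →L[ℂ] HybridSpace d}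
    (hS : ContinuousLinearMap.adjoint S = S) (hSS : S ∘L S = ρ) {ι : Type}
    (b : HilbertBasis ι ℂ (HybridSpace d)) (hb : Summable fun i => ‖S (b i)‖ ^ 2)
    (V : Qudit d →ₗᵢ[ℂ] Qumode) (ξ : PhaseSpace 2) :
    HasSum (fun i => ⟪hybridEmbedding V (S (b i)), weyl ξ (hybridEmbedding V (S (b i)))⟫_ℂ)
      (charFn (toTwoModes V ρ) ξ) := by
  set U := (hybridEmbedding V).toContinuousLinearMap with hU
  have h := hasSum_inner_of_adjoint b (stdHilbertBasis (ModeSpace 2))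
    ((weyl ξ).toContinuousLinearMap ∘L U ∘L S) (U ∘L S)
    (by simpa [hU] using hb) (by simpa [hU] using hb)
  rw [ContinuousLinearMap.adjoint_comp, hS] at h
  subst hSS
  exact h

/-! ### Slices of hybrid vectors, and states with a pure qudit marginal. -/

section Slice

variable {d : ℕ}

/-- `f ↦ c ⊗ f` for a vector `c` of the qudit. -/
def tensorLeft (c : Qudit d) : Qumode →L[ℂ] HybridSpace d :=
  LinearMap.mkContinuous (TensorProduct.mk ℂ (Qudit d) Qumode c) ‖c‖ fun f => by
    simp [TensorProduct.norm_tmul]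

theorem tensorLeft_apply (c : Qudit d) (f : Qumode) : tensorLeft c f = c ⊗ₜ[ℂ] f := rfl

theorem adjoint_tensorLeft_tmul (c v : Qudit d) (f : Qumode) :
    ContinuousLinearMap.adjoint (tensorLeft c) (v ⊗ₜ[ℂ] f) = ⟪c, v⟫_ℂ • f := by
  refine ext_inner_left ℂ fun g => ?_
  rw [ContinuousLinearMap.adjoint_inner_right, tensorLeft_apply, TensorProduct.inner_tmul,
    inner_smul_right]

theorem sum_tensorLeft_adjoint (x : HybridSpace d) :
    ∑ m, EuclideanSpace.single m (1 : ℂ) ⊗ₜ[ℂ]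
      ContinuousLinearMap.adjoint (tensorLeft (EuclideanSpace.single m (1 : ℂ))) x = x := by
  obtain ⟨f, rfl⟩ := hybridIsometry_surjective d x
  change ∑ m, EuclideanSpace.single m (1 : ℂ) ⊗ₜ[ℂ]
    ContinuousLinearMap.adjoint (tensorLeft (EuclideanSpace.single m (1 : ℂ)))
      (∑ n, EuclideanSpace.single n (1 : ℂ) ⊗ₜ[ℂ] f n) =
    ∑ m, EuclideanSpace.single m (1 : ℂ) ⊗ₜ[ℂ] f m
  refine Finset.sum_congr rfl fun m _ => ?_
  rw [map_sum, Finset.sum_eq_single m]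
  · simp [adjoint_tensorLeft_tmul]
  · intro n _ hn
    simp [adjoint_tensorLeft_tmul, EuclideanSpace.inner_single_left, hn.symm]
  · simp

theorem tensorLeft_add (c c' : Qudit d) : tensorLeft (c + c') = tensorLeft c + tensorLeft c' := by
  ext1 f
  simp [tensorLeft_apply, TensorProduct.add_tmul]

theorem tensorLeft_smul (a : ℂ) (c : Qudit d) : tensorLeft (a • c) = a • tensorLeft c := by
  ext1 f
  simp [tensorLeft_apply, TensorProduct.smul_tmul']

/-- A vector all of whose slices orthogonal to `c` vanish lies in `c ⊗ L²(ℝ)`. -/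
theorem tensorLeft_adjoint_eq_self {c : Qudit d} (hc : ‖c‖ = 1) {x : HybridSpace d}
    (hx : ∀ t : Qudit d, ⟪t, c⟫_ℂ = 0 → ContinuousLinearMap.adjoint (tensorLeft t) x = 0) :
    tensorLeft c (ContinuousLinearMap.adjoint (tensorLeft c) x) = x := by
  have hcc : ⟪c, c⟫_ℂ = 1 := by rw [inner_self_eq_norm_sq_to_K, hc]; simp
  have key (v : Qudit d) : ContinuousLinearMap.adjoint (tensorLeft v) x
      = ⟪v, c⟫_ℂ • ContinuousLinearMap.adjoint (tensorLeft c) x := by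
    -- The hypothesis is applied to the component of `v` orthogonal to `c`.
    have h := hx (v - ⟪c, v⟫_ℂ • c) (by
      rw [inner_sub_left, inner_smul_left, hcc, inner_conj_symm, mul_one, sub_self])
    rw [sub_eq_add_neg, ← neg_smul, tensorLeft_add, tensorLeft_smul, map_add,
      LinearIsometryEquiv.map_smulₛₗ] at h
    simp only [add_apply, map_neg,
      inner_conj_symm, neg_smul] at h
    exact eq_of_sub_eq_zero (by rw [sub_eq_add_neg]; exact h)
  conv_rhs => rw [← sum_tensorLeft_adjoint x]
  rw [tensorLeft_apply]
  have hsum : c = ∑ m, ⟪EuclideanSpace.single m (1 : ℂ), c⟫_ℂ • EuclideanSpace.single m (1 : ℂ) := by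
    ext k
    simp [Pi.single_apply, EuclideanSpace.inner_single_left]
  generalize ContinuousLinearMap.adjoint (tensorLeft c) x = g at key ⊢
  conv_lhs => rw [hsum, TensorProduct.sum_tmul]
  refine Finset.sum_congr rfl fun m _ => ?_
  conv_rhs => rw [key, TensorProduct.tmul_smul]
  rw [TensorProduct.smul_tmul']

/-- The projection onto a unit vector. -/
theorem isDensityOperator_rankOne {c : Qudit d} (hc : ‖c‖ = 1) :
    IsDensityOperator (InnerProductSpace.rankOne ℂ c c) := by
  refine ⟨InnerProductSpace.isPositive_rankOne_self c, fun ι b => ?_⟩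
  have h := b.hasSum_inner_mul_inner c c
  rw [inner_self_eq_norm_sq_to_K, hc] at h
  convert! h using 2 with i
  · simp
  · simp

/-- With `J = tensorLeft c`, the operator `P = J J†` is the projection `|c⟩⟨c| ⊗ 1`. The hypothesis
gives `P S = S`, and taking adjoints `S P = S`. Hence `ρ = P ρ P = J (J† ρ J) J†`, which is `|c⟩⟨c|
⊗ (J† ρ J)`. -/
theorem isProductState_of_range {S ρ : HybridSpace d →L[ℂ] HybridSpace d}
    (hS : ContinuousLinearMap.adjoint S = S) (hSS : S ∘L S = ρ) {ι : Type}
    (b : HilbertBasis ι ℂ (HybridSpace d)) (hb : HasSum (fun i => ‖S (b i)‖ ^ 2) 1)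
    {c : Qudit d} (hc : ‖c‖ = 1) (hx : ∀ i (t : Qudit d), ⟪t, c⟫_ℂ = 0 →
      ContinuousLinearMap.adjoint (tensorLeft t) (S (b i)) = 0) :
    IsProductState ρ := by
  have hJJ (f : Qumode) :
      ContinuousLinearMap.adjoint (tensorLeft c) (tensorLeft c f) = f := by
    rw [tensorLeft_apply, adjoint_tensorLeft_tmul, inner_self_eq_norm_sq_to_K, hc]
    simp
  have hnorm (f : Qumode) : ‖tensorLeft c f‖ = ‖f‖ := by
    rw [tensorLeft_apply, TensorProduct.norm_tmul, hc, one_mul]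
  have hPb (i : ι) := tensorLeft_adjoint_eq_self hc (hx i)
  have hPS : tensorLeft c ∘L ContinuousLinearMap.adjoint (tensorLeft c) ∘L S = S := by
    refine ContinuousLinearMap.ext_on (Submodule.dense_iff_topologicalClosure_eq_top.2 b.dense_span) ?_
    rintro _ ⟨i, rfl⟩
    exact hPb i
  have hSP : S ∘L tensorLeft c ∘L ContinuousLinearMap.adjoint (tensorLeft c) = S := by
    have h := congrArg ContinuousLinearMap.adjoint hPS
    simpa only [ContinuousLinearMap.adjoint_comp, ContinuousLinearMap.adjoint_adjoint, hS,
      ContinuousLinearMap.comp_assoc] using h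
  refine ⟨InnerProductSpace.rankOne ℂ c c,
    ContinuousLinearMap.adjoint (tensorLeft c) ∘L ρ ∘L tensorLeft c,
    isDensityOperator_rankOne hc, ⟨?_, fun κ e => ?_⟩, ?_⟩
  · exact ContinuousLinearMap.IsPositive.adjoint_conj (by
      have h := ContinuousLinearMap.isPositive_adjoint_comp_self S
      rwa [hS, hSS] at h) _
  -- The trace of `J† ρ J` is the squared Hilbert-Schmidt norm of `S J = (J† S)†`, hence that of `J†
  -- S`; this equals that of `S` because `J` is isometric and `J J† S = S`.
  · have h := hasSum_norm_adjoint_sq b e (ContinuousLinearMap.adjoint (tensorLeft c) ∘L S) (s := 1)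
      (by
        convert! hb using 3 with i
        rw [ContinuousLinearMap.comp_apply, ← hnorm, hPb])
    rw [ContinuousLinearMap.adjoint_comp, ContinuousLinearMap.adjoint_adjoint, hS] at h
    convert! h.mapL ofRealCLM using 2 with k
    · rw [ContinuousLinearMap.comp_apply, ContinuousLinearMap.adjoint_inner_right, ← hSS,
        ContinuousLinearMap.comp_apply, ContinuousLinearMap.comp_apply,
        ← ContinuousLinearMap.adjoint_inner_left, hS, inner_self_eq_norm_sq_to_K]
      simp
  · have h : ρ = tensorLeft c ∘L (ContinuousLinearMap.adjoint (tensorLeft c) ∘L ρ ∘L tensorLeft c) ∘L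
        ContinuousLinearMap.adjoint (tensorLeft c) := by
      conv_lhs => rw [← hSS, ← hPS]
      conv_lhs => enter [2]; rw [hPS, ← hSP]
      rw [← hSS]
      rfl
    generalize ContinuousLinearMap.adjoint (tensorLeft c) ∘L ρ ∘L tensorLeft c = B at h ⊢
    rw [h]
    refine ContinuousLinearMap.coe_injective (TensorProduct.ext' fun v f => ?_)
    simp only [ContinuousLinearMap.coe_coe, ContinuousLinearMap.comp_apply,
      adjoint_tensorLeft_tmul, TensorProduct.mapL_tmul, InnerProductSpace.rankOne_apply, map_smul,
      tensorLeft_apply, TensorProduct.smul_tmul']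

theorem IsProductState.isSeparable {ρ : HybridSpace d →L[ℂ] HybridSpace d}
    (h : IsProductState ρ) : IsSeparable ρ := by
  obtain ⟨A, B, hA, hB, rfl⟩ := h
  refine ⟨fun i => if i = 0 then 1 else 0, fun _ => A, fun _ => B, fun i => ?_,
    hasSum_ite_eq 0 1, fun _ => hA, fun _ => hB, ?_⟩
  · dsimp only
    split_ifs <;> norm_num
  · convert! hasSum_ite_eq 0 (TensorProduct.mapL A B) using 2 with i
    by_cases hi : i = 0
    · simp [hi]
    · simp only [hi, if_false, ofReal_zero]
      exact zero_smul ℂ (TensorProduct.mapL A B)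

end Slice

/-! ### Recovering a kernel from its Gaussian Weyl symbol by Fourier inversion. -/

section Fourier

open FourierTransform Real in
theorem fourier_eq_integral_mul (f : ℝ → ℂ) (w : ℝ) :
    𝓕 f w = ∫ x, f x * cexp (-(I * ((2 * π * w : ℝ) * x))) := by
  rw [Real.fourier_real_eq_integral_exp_smul]
  refine integral_congr_ae (Filter.Eventually.of_forall fun x => ?_)
  simp only [smul_eq_mul]
  rw [mul_comm]
  congr 2
  push_cast
  ring

open FourierTransform in
/-- An integrable function with vanishing Fourier transform vanishes almost everywhere. -/
theorem ae_eq_zero_of_fourier_eq_zero {f : ℝ → ℂ} (hf : Integrable f) (h : ∀ w, 𝓕 f w = 0) :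
    ∀ᵐ x, f x = 0 := by
  refine ae_eq_zero_of_integral_contDiff_smul_eq_zero hf.locallyIntegrable fun g hg hc => ?_
  have hc' : HasCompactSupport (Complex.ofRealCLM ∘ g) := hc.comp_left rfl
  have hg' : ContDiff ℝ ((⊤ : ℕ∞) : WithTop ℕ∞) (Complex.ofRealCLM ∘ g) := by fun_prop
  set φ := hc'.toSchwartzMap hg' with hφ
  set ψ : SchwartzMap ℝ ℂ := 𝓕⁻ φ with hψ
  -- Every test function is the transform of a Schwartz function `ψ`, and moving the transform
  -- across the integral gives `∫ f φ = ∫ (𝓕 f) ψ = 0`.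
  have key := VectorFourier.integral_fourierIntegral_smul_eq_flip (μ := volume) (ν := volume)
    (L := innerₗ ℝ) Real.continuous_fourierChar
    continuous_inner hf ψ.integrable
  have h1 : ∀ ξ, VectorFourier.fourierIntegral Real.fourierChar volume (innerₗ ℝ) f ξ = 0 := h
  have h2 : VectorFourier.fourierIntegral Real.fourierChar volume (innerₗ ℝ).flip ⇑ψ = φ := by
    rw [flip_innerₗ]
    change 𝓕 (⇑ψ) = ⇑φ
    rw [← SchwartzMap.fourier_coe, hψ, FourierTransform.fourier_fourierInv_eq]
  simp only [h1, zero_smul, integral_zero, h2] at key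
  rw [key]
  refine integral_congr_ae (Filter.Eventually.of_forall fun x => ?_)
  simp [hφ, mul_comm]

open FourierTransform Real in
theorem ae_eq_of_integral_mul_exp_eq {f g : ℝ → ℂ} (hf : Integrable f) (hg : Integrable g)
    (h : ∀ b : ℝ, ∫ x, f x * cexp (-(I * (b * x))) = ∫ x, g x * cexp (-(I * (b * x)))) :
    ∀ᵐ x, f x = g x := by
  have h0 := ae_eq_zero_of_fourier_eq_zero (hf.sub hg) fun w => by
    have hsub : 𝓕 (f - g) w = 𝓕 f w - 𝓕 g w := by
      simp only [Real.fourier_real_eq, Pi.sub_apply, smul_sub]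
      rw [integral_sub]
      · simpa [mul_comm] using (Real.fourierIntegral_convergent_iff w).2 hf
      · simpa [mul_comm] using (Real.fourierIntegral_convergent_iff w).2 hg
    rw [hsub, fourier_eq_integral_mul, fourier_eq_integral_mul, h, sub_self]
  filter_upwards [h0] with x hx
  exact sub_eq_zero.1 hx

open FourierTransform Real in
/-- The decay rate of a Gaussian Fourier transform of an integrable function is positive. -/
theorem pos_of_integral_mul_exp_eq {f : ℝ → ℂ} {C : ℝ} {l : ℝ}
    (h : ∀ b : ℝ, ∫ x, f x * cexp (-(I * (b * x))) = cexp (-(C * b ^ 2) + I * (l * b))) :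
    0 < C := by
  by_contra! hC
  -- Riemann-Lebesgue, which needs no integrability here: for a non-integrable `f` the integral is
  -- `0` by convention. For `C ≤ 0` the modulus of the transform would stay at least `1`.
  have h0 := (Real.zero_at_infty_fourier f).norm
  have h1 : ∀ w, 1 ≤ ‖𝓕 f w‖ := fun w => by
    rw [fourier_eq_integral_mul, h, Complex.norm_exp, Real.one_le_exp_iff]
    have : (-((C : ℂ) * ((2 * π * w : ℝ) : ℂ) ^ 2) + I * (l * ((2 * π * w : ℝ) : ℂ))).re
        = -(C * (2 * π * w) ^ 2) := by
      rw [add_re, neg_re, ← ofReal_pow, ← ofReal_mul, ← ofReal_mul, I_mul_re, ofReal_re,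
        ofReal_im, neg_zero, add_zero]
    rw [this]
    nlinarith [sq_nonneg (2 * π * w)]
  rw [norm_zero] at h0
  exact absurd (ge_of_tendsto h0 (Filter.Eventually.of_forall h1)) (by norm_num)

/-- An integral kernel whose Weyl symbol is Gaussian is the exponential of a quadratic form. -/
theorem exists_kernel_eq_exp {k : ℝ → ℝ → ℂ} (hk : ∀ a, Integrable fun x => k x (x + a))
    {A B C l₀ l₁ : ℝ}
    (h : ∀ a b : ℝ, ∫ x, k x (x + a) * cexp (-(I * (b * x + a * b / 2))) =
      cexp (-(A * a ^ 2 + B * a * b + C * b ^ 2) + I * (l₀ * a + l₁ * b))) :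
    ∃ (β : ℂ) (u v : ℝ → ℂ), Continuous u ∧ Continuous v ∧
      ∀ a, ∀ᵐ x : ℝ, k x (x + a) = cexp (u x + v (x + a) + β * x * (x + a : ℝ)) := by
  have hC : 0 < C := by
    refine pos_of_integral_mul_exp_eq (f := fun x => k x (x + 0)) (l := l₁) fun b => ?_
    convert h 0 b using 3 <;> simp
  have hC' : (C : ℂ) ≠ 0 := ofReal_ne_zero.2 hC.ne'
  have hτ : (-(1 / (4 * C)) : ℂ).re < 0 := by
    have : (-(1 / (4 * C)) : ℂ) = ((-(1 / (4 * C)) : ℝ) : ℂ) := by push_cast; rfl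
    rw [this, ofReal_re]
    exact neg_neg_of_pos (by positivity)
  have hN : ((Real.pi / -(-(1 / (4 * C)) : ℂ)) ^ (1 / 2 : ℂ)) ≠ 0 := by
    rw [Ne, Complex.cpow_eq_zero_iff, not_and_or]
    left
    rw [neg_neg]
    exact div_ne_zero (ofReal_ne_zero.2 Real.pi_ne_zero)
      (one_div_ne_zero (mul_ne_zero (by norm_num) hC'))
  set N : ℂ := ((Real.pi / -(-(1 / (4 * C)) : ℂ)) ^ (1 / 2 : ℂ)) with hNdef
  -- For fixed `a` the function sought is `exp(-x² / (4C) + s x + r)`, whose transform is `N exp(r +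
  -- C (s - I b)²)`. Matching the terms linear in `b` forces `s = c₁ a + c₀`; the constant terms
  -- then give `r = -A a² + I l₀ a - C s² - log N`.
  set c₁ : ℂ := (-(1 / 2) - I * B) / (2 * C) with hc₁
  set c₀ : ℂ := -l₁ / (2 * C) with hc₀
  -- Substituting `a = y - x` in the exponent and collecting the terms in `x y`, in `x` and in `y`.
  refine ⟨c₁ + 2 * A + 2 * C * c₁ ^ 2,
    fun x => -(1 / (4 * C)) * x ^ 2 - c₁ * x ^ 2 + c₀ * x - A * x ^ 2 - I * l₀ * x
      - C * c₁ ^ 2 * x ^ 2 + 2 * C * c₁ * c₀ * x - C * c₀ ^ 2 - Complex.log N,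
    fun y => -A * y ^ 2 + I * l₀ * y - C * c₁ ^ 2 * y ^ 2 - 2 * C * c₁ * c₀ * y,
    by fun_prop, by fun_prop, fun a => ?_⟩
  have hg := integrable_cexp_quadratic' hτ (c₁ * a + c₀)
    (-A * a ^ 2 + I * l₀ * a - C * (c₁ * a + c₀) ^ 2 - Complex.log N)
  have hae := ae_eq_of_integral_mul_exp_eq (hk a) hg fun b => by
    have e1 : ∀ x : ℝ, k x (x + a) * cexp (-(I * (b * x)))
        = cexp (I * (a * b / 2)) * (k x (x + a) * cexp (-(I * (b * x + a * b / 2)))) := fun x => by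
      conv_rhs => rw [mul_left_comm, ← Complex.exp_add]
      congr 2
      ring
    have e2 : ∀ x : ℝ, cexp (-(1 / (4 * C)) * x ^ 2 + (c₁ * a + c₀) * x +
          (-A * a ^ 2 + I * l₀ * a - C * (c₁ * a + c₀) ^ 2 - Complex.log N))
            * cexp (-(I * (b * x)))
        = cexp (-(1 / (4 * C)) * x ^ 2 + (c₁ * a + c₀ - I * b) * x +
          (-A * a ^ 2 + I * l₀ * a - C * (c₁ * a + c₀) ^ 2 - Complex.log N)) := fun x => by
      rw [← Complex.exp_add]
      congr 1
      ring
    simp_rw [e1, e2]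
    rw [integral_const_mul, h, integral_cexp_quadratic hτ, ← hNdef, ← Complex.exp_add]
    have hL := Complex.exp_log hN
    generalize Complex.log N = L at hL
    rw [← hL, ← Complex.exp_add]
    congr 1
    rw [hc₁, hc₀]
    field_simp
    ring_nf
    simp only [I_sq]
    ring
  filter_upwards [hae] with x hx
  rw [hx]
  congr 1
  push_cast
  ring

end Fourier

/-! ### Finite-rank kernels of exponential form. -/

section LinearAlgebra

/-- Exponentials with distinct rates are linearly independent. -/
theorem linearIndependent_exp_mul {β : ℂ} (hβ : β ≠ 0) {κ : Type} {x : κ → ℝ}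
    (hx : Function.Injective x) : LinearIndependent ℂ fun i (y : ℝ) => cexp (β * x i * y) := by
  -- Dedekind's independence of characters applies; the characters are told apart by their
  -- derivatives `β * x i` at `0`.
  let χ : κ → (Multiplicative ℝ →* ℂ) := fun i =>
    { toFun := fun y => cexp (β * x i * (Multiplicative.toAdd y : ℝ))
      map_one' := by simp
      map_mul' := fun y z => by
        rw [← Complex.exp_add, toAdd_mul]
        push_cast
        ring_nf }
  have hχ : Function.Injective χ := by
    intro i j hij
    by_contra hne
    have hd : x i - x j ≠ 0 := sub_ne_zero.2 fun h => hne (hx h)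
    have hval (y : ℝ) : cexp (β * x i * y) = cexp (β * x j * y) :=
      DFunLike.congr_fun hij (Multiplicative.ofAdd y)
    have hderiv (t : ℝ) : HasDerivAt (fun y : ℝ => cexp (β * t * y)) (β * t) 0 := by
      have h1 : HasDerivAt (fun y : ℝ => β * t * (y : ℂ)) (β * t) 0 := by
        simpa using (Complex.ofRealCLM.hasDerivAt (x := (0 : ℝ))).const_mul (β * t)
      simpa using h1.cexp
    have h2 := (hderiv (x i)).unique (by simpa only [hval] using hderiv (x j))
    exact hd (sub_eq_zero.2 (ofReal_injective (mul_left_cancel₀ hβ h2)))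
  exact (linearIndependent_monoidHom (Multiplicative ℝ) ℂ).comp χ hχ

theorem infinite_of_ae {p : ℝ → Prop} (h : ∀ᵐ x, p x) : {x | p x}.Infinite := by
  intro hfin
  have h1 : volume ({x | p x} ∪ {x | p x}ᶜ) = 0 :=
    measure_union_null (hfin.measure_zero volume) (ae_iff.1 h)
  rw [Set.union_compl_self] at h1
  simp at h1

variable {d : ℕ}

theorem sum_smul_ae_eq {κ : Type} (s : Finset κ) (v : κ → Qumode) (a : κ → ℂ) :
    ∀ᵐ y, (∑ n ∈ s, a n • v n : Qumode) y = ∑ n ∈ s, a n * v n y := by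
  classical
  induction s using Finset.induction_on with
  | empty =>
    simp only [Finset.sum_empty]
    exact Lp.coeFn_zero ℂ 2 volume
  | insert n s hn ih =>
    rw [Finset.sum_insert hn]
    filter_upwards [ih, Lp.coeFn_add (a n • v n) (∑ n ∈ s, a n • v n), Lp.coeFn_smul (a n) (v n)]
      with y h1 h2 h3
    rw [h2, Finset.sum_insert hn, Pi.add_apply, h1, h3, Pi.smul_apply, smul_eq_mul]

theorem eq_zero_of_sum_ae_eq_zero {v : Fin d → Qumode} (hv : LinearIndependent ℂ v)
    {a : Fin d → ℂ} (h : ∀ᵐ y, ∑ n, a n * v n y = 0) (n : Fin d) : a n = 0 := by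
  refine Fintype.linearIndependent_iff.1 hv a ?_ n
  rw [Lp.eq_zero_iff_ae_eq_zero]
  filter_upwards [h, sum_smul_ae_eq Finset.univ v a] with y h1 h2
  rw [h2, h1]
  rfl

/-- A finite-rank kernel that is the exponential of a quadratic form has no cross term. -/
theorem cross_term_eq_zero {v : Fin d → ℝ → ℂ} {γ : ℝ → Fin d → ℂ} {u w : ℝ → ℂ} {β : ℂ}
    (h : ∀ᵐ x : ℝ, ∀ᵐ y : ℝ, ∑ n, γ x n * v n y = cexp (u x + w y + β * x * y)) : β = 0 := by
  by_contra hβ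
  let e := (infinite_of_ae h).natEmbedding
  -- Infinitely many vectors in `ℂ^d` are dependent, and the relation passes to the exponentials `y
  -- ↦ exp(β x y)` at those points `x`.
  have hdep : ¬ LinearIndependent ℂ fun i => γ (e i) := fun hli =>
    not_finite_iff_infinite.2 (inferInstance : Infinite ℕ) hli.finite
  obtain ⟨s, g, hg, i, hi, hgi⟩ := not_linearIndependent_iff.1 hdep
  have hli := linearIndependent_exp_mul hβ (x := fun i => (e i : ℝ))
    (Subtype.val_injective.comp e.injective)
  -- Only countably many points were chosen, so one null set of `y` serves them all.
  have hall : ∀ᵐ y : ℝ, ∀ i, ∑ n, γ (e i) n * v n y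
      = cexp (u (e i) + w y + β * (e i : ℝ) * y) := ae_all_iff.2 fun i => (e i).2
  have hae : ∀ᵐ y : ℝ, ∑ i ∈ s, (g i * cexp (u (e i))) * cexp (β * (e i : ℝ) * y) = 0 := by
    filter_upwards [hall] with y hy
    have h1 : ∑ i ∈ s, g i * ∑ n, γ (e i) n * v n y = 0 := by
      simp_rw [Finset.mul_sum]
      rw [Finset.sum_comm]
      refine Finset.sum_eq_zero fun n _ => ?_
      have := congrFun hg n
      simp only [Finset.sum_apply, Pi.smul_apply, smul_eq_mul, Pi.zero_apply] at this
      simp_rw [← mul_assoc]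
      rw [← Finset.sum_mul, this, zero_mul]
    simp_rw [hy] at h1
    refine (mul_eq_zero.1 (?_ : cexp (w y) * _ = 0)).resolve_left (Complex.exp_ne_zero _)
    rw [Finset.mul_sum, ← h1]
    refine Finset.sum_congr rfl fun i _ => ?_
    rw [Complex.exp_add, Complex.exp_add]
    ring
  -- Continuity upgrades the almost-everywhere relation to every `y`, contradicting independence.
  have hcont : (fun y : ℝ => ∑ i ∈ s, (g i * cexp (u (e i))) * cexp (β * (e i : ℝ) * y))
      = fun _ => 0 :=
    (Continuous.ae_eq_iff_eq volume (by fun_prop) continuous_const).1 hae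
  have h2 := linearIndependent_iff'.1 hli s (fun i => g i * cexp (u (e i))) (by
    ext y
    simpa using congrFun hcont y) i hi
  exact hgi ((mul_eq_zero.1 h2).resolve_right (Complex.exp_ne_zero _))

/-- A finite-rank kernel that is the exponential of a quadratic form has rank one. -/
theorem exists_rank_one {v : Fin d → Qumode} (hv : LinearIndependent ℂ v)
    {G : Fin d → Fin d → ℂ} {u w : ℝ → ℂ} {β : ℂ}
    (h : ∀ᵐ x : ℝ, ∀ᵐ y : ℝ, ∑ m, ∑ n, G m n * (starRingEnd ℂ (v m x) * v n y)
      = cexp (u x + w y + β * x * y)) :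
    ∃ γ : Fin d → ℂ, γ ≠ 0 ∧ ∀ t : Fin d → ℂ, ∑ n, t n * γ n = 0 →
      ∀ m, ∑ n, G m n * t n = 0 := by
  set γ : ℝ → Fin d → ℂ := fun x n => ∑ m, G m n * starRingEnd ℂ (v m x) with hγ
  have hγ' : ∀ᵐ x : ℝ, ∀ᵐ y : ℝ, ∑ n, γ x n * v n y = cexp (u x + w y + β * x * y) := by
    filter_upwards [h] with x hx
    filter_upwards [hx] with y hy
    rw [← hy, Finset.sum_comm]
    refine Finset.sum_congr rfl fun n _ => ?_
    rw [hγ, Finset.sum_mul]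
    exact Finset.sum_congr rfl fun m _ => mul_assoc _ _ _
  obtain rfl := cross_term_eq_zero hγ'
  simp only [zero_mul, add_zero] at hγ'
  obtain ⟨x₀, hx₀⟩ := hγ'.exists
  refine ⟨γ x₀, fun h0 => ?_, fun t ht => ?_⟩
  · obtain ⟨y, hy⟩ := hx₀.exists
    simp only [h0, Pi.zero_apply, zero_mul, Finset.sum_const_zero] at hy
    exact Complex.exp_ne_zero _ hy.symm
  -- Without cross term, `∑ n, γ x n * v n` depends on `x` only through the scalar `exp(u x)`, so
  -- independence of `v` makes all `γ x` proportional to `γ x₀`.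
  · have hprop : ∀ᵐ x : ℝ, ∀ n, γ x n = cexp (u x - u x₀) * γ x₀ n := by
      filter_upwards [hγ'] with x hx n
      refine sub_eq_zero.1 (eq_zero_of_sum_ae_eq_zero hv
        (a := fun n => γ x n - cexp (u x - u x₀) * γ x₀ n) ?_ n)
      filter_upwards [hx, hx₀] with y h1 h2
      simp only [sub_mul, Finset.sum_sub_distrib, mul_assoc]
      rw [← Finset.mul_sum, h1, h2, ← Complex.exp_add, sub_eq_zero]
      congr 1
      ring
    -- A `t` annihilating `γ x₀` annihilates almost every `γ x`; conjugating gives a relation among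
    -- the `v m`, so independence is used a second time.
    have hsum : ∀ᵐ x : ℝ, ∑ m, starRingEnd ℂ (∑ n, G m n * t n) * v m x = 0 := by
      filter_upwards [hprop] with x hx
      have h1 : ∑ n, t n * γ x n = 0 := by
        simp_rw [hx, mul_left_comm (t _)]
        rw [← Finset.mul_sum, ht, mul_zero]
      rw [← map_eq_zero_iff (starRingEnd ℂ) (RingHom.injective _), ← h1, map_sum]
      simp only [hγ, map_mul, map_sum, Complex.conj_conj, Finset.sum_mul, Finset.mul_sum]
      rw [Finset.sum_comm]
      exact Finset.sum_congr rfl fun n _ => Finset.sum_congr rfl fun m _ => by ring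
    intro m
    exact (map_eq_zero_iff (starRingEnd ℂ) (RingHom.injective _)).1
      (eq_zero_of_sum_ae_eq_zero hv hsum m)

end LinearAlgebra

/-! ### Restriction to the first mode and the reduced qudit state. -/

section Reduction

/-- The phase space vector with components `(a, b)` in the first mode and `0` in the second. -/
def firstMode (a b : ℝ) : PhaseSpace 2 := fun p => ![![a, b], ![0, 0]] p.1 p.2

/-- A Weyl operator of the first mode leaves the second factor alone, so the integral over the plane
splits; the factor `⟪g, g'⟫` is what performs the partial trace. -/
theorem inner_weyl_pairBilin (f g f' g' : Qumode) (a b : ℝ) :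
    ⟪pairBilin f g, weyl (firstMode a b) (pairBilin f' g')⟫_ℂ =
      (∫ x : ℝ, starRingEnd ℂ (f x) * f' (x + a) * cexp (-(I * (b * x + a * b / 2))))
        * ⟪g, g'⟫_ℂ := by
  rw [L2.inner_def, L2.inner_def]
  have h := integral_fintype_prod_volume_eq_prod
    (![fun t : ℝ => starRingEnd ℂ (f t) * f' (t + a) * cexp (-(I * (b * t + a * b / 2))),
      fun t : ℝ => ⟪g t, g' t⟫_ℂ])
  simp only [Fin.prod_univ_two, Matrix.cons_val_zero, Matrix.cons_val_one] at h
  rw [← h]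
  refine integral_congr_ae ?_
  have hshift := (measurePreserving_shift (firstMode a b)).quasiMeasurePreserving.ae_eq_comp
    (memLp_mul_pair f' g').coeFn_toLp
  filter_upwards [(memLp_mul_pair f g).coeFn_toLp, hshift,
    (memLp_weyl (firstMode a b) (pairBilin f' g')).coeFn_toLp] with x h1 h2 h3
  have h4 : (weyl (firstMode a b) (pairBilin f' g')) x = weylPhase (firstMode a b) x *
    (pairBilin f' g') (x + fun j => firstMode a b (j, 0)) := h3
  have h5 : (pairBilin f' g') (x + fun j => firstMode a b (j, 0)) = f' (x 0 + a) * g' (x 1) := by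
    simpa [firstMode] using! h2
  have h6 : weylPhase (firstMode a b) x = cexp (-(I * (b * x 0 + a * b / 2))) := by
    simp [weylPhase, firstMode]
  rw [h4, h5, h6]
  simp only [pairBilin, LinearMap.mk₂_apply]
  rw [h1]
  simp only [RCLike.inner_apply, map_mul]
  ring

theorem weyl_zero {N : ℕ} (f : ModeSpace N) : weyl (0 : PhaseSpace N) f = f := by
  refine Lp.ext ?_
  filter_upwards [(memLp_weyl (0 : PhaseSpace N) f).coeFn_toLp] with x hx
  refine (show (weyl (0 : PhaseSpace N) f) x = _ from hx).trans ?_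
  have h : (x + fun j : Fin N => (0 : PhaseSpace N) (j, 0)) = x := by
    ext j
    simp
  rw [h]
  simp [weylPhase]

variable {d : ℕ}

/-- The component `x_m` of `x = ∑ m, |m⟩ ⊗ x_m`. -/
def component (m : Fin d) : HybridSpace d →L[ℂ] Qumode :=
  ContinuousLinearMap.adjoint (tensorLeft (EuclideanSpace.single m (1 : ℂ)))

theorem norm_component_le (m : Fin d) (x : HybridSpace d) : ‖component m x‖ ≤ ‖x‖ := by
  refine (ContinuousLinearMap.le_opNorm _ _).trans (mul_le_of_le_one_left (norm_nonneg _) ?_)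
  rw [component, LinearIsometryEquiv.norm_map]
  refine (LinearMap.mkContinuous_norm_le _ (norm_nonneg _) _).trans ?_
  simp

theorem adjoint_tensorLeft_eq_sum (t : Qudit d) (x : HybridSpace d) :
    ContinuousLinearMap.adjoint (tensorLeft t) x = ∑ m, starRingEnd ℂ (t m) • component m x := by
  conv_lhs => rw [← sum_tensorLeft_adjoint x, map_sum]
  refine Finset.sum_congr rfl fun m _ => ?_
  rw [adjoint_tensorLeft_tmul, EuclideanSpace.inner_single_right, one_mul]
  rfl

theorem hybridEmbedding_eq_sum (V : Qudit d →ₗᵢ[ℂ] Qumode) (x : HybridSpace d) :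
    hybridEmbedding V x = ∑ m, pairBilin (V (EuclideanSpace.single m 1)) (component m x) := by
  conv_lhs => rw [← sum_tensorLeft_adjoint x, map_sum]
  rfl

/-- The kernel of the reduced state of the qudit. -/
def kernel (G : Fin d → Fin d → ℂ) (v : Fin d → Qumode) (x y : ℝ) : ℂ :=
  ∑ m, ∑ n, G m n * (starRingEnd ℂ (v m x) * v n y)

theorem integrable_conj_mul_shift (f g : Qumode) (a : ℝ) :
    Integrable fun x => starRingEnd ℂ (f x) * g (x + a) :=
  MemLp.integrable_mul (p := 2) (q := 2) (Lp.memLp f).star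
    ((Lp.memLp g).comp_measurePreserving (measurePreserving_add_right volume a))

theorem integrable_kernel (G : Fin d → Fin d → ℂ) (v : Fin d → Qumode) (a : ℝ) :
    Integrable fun x => kernel G v x (x + a) :=
  integrable_finsetSum _ fun m _ => integrable_finsetSum _ fun n _ =>
    (integrable_conj_mul_shift (v m) (v n) a).const_mul (G m n)

theorem measurable_kernel (G : Fin d → Fin d → ℂ) (v : Fin d → Qumode) :
    Measurable fun p : ℝ × ℝ => kernel G v p.1 p.2 := by
  have hv (n : Fin d) : Measurable (v n) := (Lp.stronglyMeasurable (v n)).measurable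
  unfold kernel
  refine Finset.measurable_sum _ fun m _ => Finset.measurable_sum _ fun n _ => ?_
  exact measurable_const.mul ((Complex.continuous_conj.measurable.comp
    ((hv m).comp measurable_fst)).mul ((hv n).comp measurable_snd))

theorem integral_kernel_mul (G : Fin d → Fin d → ℂ) (v : Fin d → Qumode) (a b : ℝ) :
    ∫ x, kernel G v x (x + a) * cexp (-(I * (b * x + a * b / 2))) =
      ∑ m, ∑ n, G m n * ∫ x, starRingEnd ℂ (v m x) * v n (x + a)
        * cexp (-(I * (b * x + a * b / 2))) := by
  have hint (m n : Fin d) : Integrable fun x : ℝ =>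
      G m n * (starRingEnd ℂ (v m x) * v n (x + a) * cexp (-(I * (b * x + a * b / 2)))) := by
    refine ((integrable_conj_mul_shift (v m) (v n) a).mul_bdd (c := 1)
      (by fun_prop) (Filter.Eventually.of_forall fun x => ?_)).const_mul _
    have : -(I * ((b : ℂ) * x + a * b / 2)) = ((-(b * x + a * b / 2) : ℝ) : ℂ) * I := by
      push_cast
      ring
    rw [this, Complex.norm_exp_ofReal_mul_I]
  simp_rw [← integral_const_mul, kernel, Finset.sum_mul]
  rw [integral_finsetSum _ fun m _ => ?_]
  · refine Finset.sum_congr rfl fun m _ => ?_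
    rw [integral_finsetSum _ fun n _ => ?_]
    · simp only [mul_assoc]
    · simpa only [mul_assoc] using hint m n
  · refine integrable_finsetSum _ fun n _ => ?_
    simpa only [mul_assoc] using hint m n

/-- Tonelli for null sets swaps the quantifiers over `a` and `x`, and translation invariance then
replaces `a` by `y - x`. Measurability is needed for the swap. -/
theorem ae_ae_of_forall_shift {p : ℝ → ℝ → Prop} (hp : MeasurableSet {q : ℝ × ℝ | p q.1 q.2})
    (h : ∀ a, ∀ᵐ x, p x (x + a)) : ∀ᵐ x, ∀ᵐ y, p x y := by
  have hm : MeasurableSet {q : ℝ × ℝ | p q.2 (q.2 + q.1)} :=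
    hp.preimage (f := fun q : ℝ × ℝ => (q.2, q.2 + q.1)) (by fun_prop)
  have h1 := (Measure.ae_ae_comm (μ := volume) (ν := volume) hm).1
    (Filter.Eventually.of_forall h)
  filter_upwards [h1] with x hx
  have h2 := (measurePreserving_add_left volume (-x)).quasiMeasurePreserving.ae hx
  filter_upwards [h2] with y hy
  simpa using hy

theorem gaussian_exponent_firstMode (M : Matrix (Fin 2 × Fin 2) (Fin 2 × Fin 2) ℝ)
    (l : PhaseSpace 2) (a b : ℝ) :
    -(1 / 4) * ((firstMode a b ⬝ᵥ (M *ᵥ firstMode a b) : ℝ) : ℂ)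
        + I * ((firstMode a b ⬝ᵥ l : ℝ) : ℂ) =
      -(((M (0, 0) (0, 0) / 4 : ℝ) : ℂ) * a ^ 2
          + (((M (0, 0) (0, 1) + M (0, 1) (0, 0)) / 4 : ℝ) : ℂ) * a * b
          + ((M (0, 1) (0, 1) / 4 : ℝ) : ℂ) * b ^ 2)
        + I * ((l (0, 0) : ℂ) * a + (l (0, 1) : ℂ) * b) := by
  simp only [dotProduct, Matrix.mulVec, Fintype.sum_prod_type, Fin.sum_univ_two, firstMode]
  simp
  ring

/-- The qudit part of a hybrid state with Gaussian characteristic function is pure. -/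
theorem isProductState_of_isGaussian {ρ : HybridSpace d →L[ℂ] HybridSpace d}
    (hρ : IsDensityOperator ρ) (V : Qudit d →ₗᵢ[ℂ] Qumode)
    (hG : IsGaussian (toTwoModes V ρ)) : IsProductState ρ := by
  obtain ⟨S, hS, hSS, hS1⟩ := hρ.exists_sqrt
  set e := stdHilbertBasis (HybridSpace d)
  have hsum := hS1 _ e
  set v : Fin d → Qumode := fun m => V (EuclideanSpace.single m 1) with hv
  have hvli : LinearIndependent ℂ v := by
    convert!
      ((EuclideanSpace.basisFun (Fin d) ℂ).orthonormal.comp_linearIsometry V).linearIndependent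
    ext1 m
    simp [hv]
  -- The Gram matrix of the components, that is, the transpose of the reduced density matrix of the
  -- qudit.
  set G : Fin d → Fin d → ℂ := fun m n =>
    ∑' i, ⟪component m (S (e i)), component n (S (e i))⟫_ℂ with hGdef
  have hGsum (m n : Fin d) :
      HasSum (fun i => ⟪component m (S (e i)), component n (S (e i))⟫_ℂ) (G m n) := by
    refine (Summable.of_norm_bounded hsum.summable fun i => ?_).hasSum
    rw [sq]
    exact (norm_inner_le_norm _ _).trans (mul_le_mul (norm_component_le _ _)
      (norm_component_le _ _) (norm_nonneg _) (norm_nonneg _))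
  have hchar (a b : ℝ) : charFn (toTwoModes V ρ) (firstMode a b)
      = ∫ x, kernel G v x (x + a) * cexp (-(I * (b * x + a * b / 2))) := by
    rw [integral_kernel_mul]
    refine (hasSum_charFn hS hSS e hsum.summable V (firstMode a b)).unique ?_
    have h := hasSum_sum (s := Finset.univ) fun m _ => hasSum_sum (s := Finset.univ) fun n _ =>
      (hGsum m n).mul_right (∫ x, starRingEnd ℂ (v m x) * v n (x + a)
        * cexp (-(I * (b * x + a * b / 2))))
    convert! h using 2 with i
    rw [hybridEmbedding_eq_sum, map_sum, sum_inner]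
    refine Finset.sum_congr rfl fun m _ => ?_
    rw [inner_sum]
    refine Finset.sum_congr rfl fun n _ => ?_
    rw [inner_weyl_pairBilin, mul_comm]
  have hchar0 : charFn (toTwoModes V ρ) 0 = 1 := by
    refine (hasSum_charFn hS hSS e hsum.summable V 0).unique ?_
    convert! hsum.mapL ofRealCLM using 2 with i
    rw [weyl_zero, LinearIsometry.inner_map_map, inner_self_eq_norm_sq_to_K]
    simp
  obtain ⟨γ, D, -, hγ⟩ := hG
  obtain ⟨β, u, w, hu, hw, hker⟩ := exists_kernel_eq_exp (integrable_kernel G v)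
    (fun a b => by rw [← hchar, hγ, hchar0, one_mul, gaussian_exponent_firstMode])
  have hkernel : ∀ᵐ x : ℝ, ∀ᵐ y : ℝ, kernel G v x y = cexp (u x + w y + β * x * y) :=
    ae_ae_of_forall_shift (measurableSet_eq_fun (measurable_kernel G v)
      (Continuous.measurable (by fun_prop))) hker
  obtain ⟨c, hc, ht⟩ := exists_rank_one hvli hkernel
  set c' : Qudit d := WithLp.toLp 2 c with hc'
  have hc0 : c' ≠ 0 := by simpa [hc'] using hc
  refine isProductState_of_range hS hSS e hsum
    (c := ((‖c'‖⁻¹ : ℝ) : ℂ) • c') ?_ fun i t hti => ?_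
  · rw [norm_smul, Complex.norm_real, norm_inv, norm_norm, inv_mul_cancel₀ (norm_ne_zero_iff.2 hc0)]
  rw [inner_smul_right] at hti
  have hti := (mul_eq_zero.1 hti).resolve_left
    (ofReal_ne_zero.2 (inv_ne_zero (norm_ne_zero_iff.2 hc0)))
  have hker0 := ht (fun n => starRingEnd ℂ (t n)) (by
    simpa [PiLp.inner_apply, hc', mul_comm] using hti)
  -- The sum of the squared norms of the `t`-slices is the quadratic form `∑ t m * G m n * conj (t
  -- n)`, which vanishes since `G` annihilates `conj t`. Being nonnegative, each term is zero.
  have hzero : HasSum (fun i => ⟪ContinuousLinearMap.adjoint (tensorLeft t) (S (e i)),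
      ContinuousLinearMap.adjoint (tensorLeft t) (S (e i))⟫_ℂ) 0 := by
    have h := hasSum_sum (s := Finset.univ) fun m _ =>
      (hasSum_sum (s := Finset.univ) fun n _ =>
        (hGsum m n).mul_right (starRingEnd ℂ (t n))).mul_left (t m)
    simp only [hker0, mul_zero, Finset.sum_const_zero] at h
    convert! h using 2 with i
    rw [adjoint_tensorLeft_eq_sum, sum_inner]
    refine Finset.sum_congr rfl fun m _ => ?_
    rw [inner_smul_left, Complex.conj_conj, inner_sum]
    congr 1
    refine Finset.sum_congr rfl fun n _ => ?_
    rw [inner_smul_right, mul_comm]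
  have hre := hzero.mapL reCLM
  simp only [reCLM_apply, map_zero, inner_self_eq_norm_sq_to_K, coe_algebraMap, ← ofReal_pow,
    ofReal_re] at hre
  have := (hasSum_zero_iff_of_nonneg fun i => sq_nonneg _).1 hre
  exact norm_eq_zero.1 (pow_eq_zero_iff two_ne_zero |>.1 (congrFun this i))

end Reduction

end HybridEntanglement

end

theorem mainTheorem1 (d : ℕ)
    (ρ : HybridEntanglement.HybridSpace d →L[ℂ] HybridEntanglement.HybridSpace d)
    (hρ : HybridEntanglement.IsDensityOperator ρ)
    (hcorr : HybridEntanglement.IsEntangled ρ ∨ HybridEntanglement.IsClassicallyCorrelated ρ)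
    (V : HybridEntanglement.Qudit d →ₗᵢ[ℂ] HybridEntanglement.Qumode) :
    ¬ HybridEntanglement.IsGaussian (HybridEntanglement.toTwoModes V ρ) := by
  intro hG
  have h := HybridEntanglement.isProductState_of_isGaussian hρ V hG
  rcases hcorr with hE | hC
  · exact hE h.isSeparable
  · exact hC.2 h
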